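/- Let $f:\mathbb R\to\mathbb R$ be convex, and let $f^*(q)=\sup_{p\in\mathbb R}(pq-f(p))\in(-\infty,+\infty]$ be its Fenchel dual (it is finite everywhere if $f$ is superlinear). For $u_0\in L^\infty(\mathbb R)$ put $v_0(x)=\int_0^x u_0(s)\,ds$, let $\mathrm{Lip}(v_0)$ be the least Lipschitz constant of $v_0$, and define $$V(x,0)=v_0(x),\qquad V(x,t)=\inf_{y\in\mathbb R}\Big\{v_0(y)+t f^*\Big(\frac{x-y}{t}\Big)\Big\}\quad(t>0),$$ $$V(x,s,t)=\inf_{y\in\mathbb R}\Big\{V(y,s)+(t-s)f^*\Big(\frac{x-y}{t-s}\Big)\Big\}\quad(0\le s<t).$$ For every $u_0\in L^\infty(\mathbb R)$ the function $V$ is finite, and: 1. $V$ is Lipschitz on $\mathbb R\times[0,\infty)$, and $|V(x,t)-V(y,t)|\le \mathrm{Lip}(v_0)\,|x-y|$ for all $x,y\in\mathbb R$ and $t>0$; more precisely, there is a constant $C$ with $|V(x,t)-V(y,s)|\le \mathrm{Lip}(v_0)|x-y|+C|t-s|$ for all $x,y\in\mathbb R$ and $s,t\ge0$. 2. (Dynamic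 programming principle) $V(x,s,t)=V(x,t)$ for all $x\in\mathbb R$ and $0\le s<t$. 3. $V$ is a viscosity solution of $V_t+f(V_x)=0$ in $\mathbb R\times(0,\infty)$ with $V(x,0)=v_0(x)$ for $x\in\mathbb R$. 4. For every $t>0$ the derivative $u(x,t)=\frac{\partial}{\partial x}V(x,t)$ exists for a.e. $x$. The function $u$ belongs to $L^\infty(\mathbb R\times(0,\infty))$ with $\|u\|_\infty\le\|u_0\|_\infty$, and it is a weak solution of $u_t+f(u)_x=0$ with initial value $u_0$: for all $\varphi\in C_c^\infty(\mathbb R\times[0,\infty))$, $$\int_0^\infty\!\!\int_{\mathbb R}\big(u\varphi_t+f(u)\varphi_x\big)\,dx\,dt+\int_{\mathbb R}u_0(x)\varphi(x,0)\,dx=0.$$ 5. ($L^1$ contraction) Let $u_{10},u_{20}\in L^\infty(\mathbb R)$, and let $u_1,u_2$ be the functions $\frac{\partial}{\partial x}V$ obtained as above from $u_0=u_{10}$ and from $u_0=u_{20}$. With $M=\max(\|u_{10}\|_\infty,\|u_{20}\|_\infty)$, the limit $$L=\lim_{\varepsilon\to0+}\operatorname{ess\,sup}\{|f'(p)|: |p|\le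 M+\varepsilon\}$$ exists and is finite, and for a.e. $t>0$ and all $a<b$, $$\int_a^b|u_1(x,t)-u_2(x,t)|\,dx\le\int_{a-Lt}^{b+Lt}|u_{10}(x)-u_{20}(x)|\,dx.$$ -/

import Mathlib

open MeasureTheory Filter Topology Set
open scoped ENNReal

noncomputable section

namespace LaxOleinik

/-- The `L^∞(ℝ)` norm, as a real number. -/
def supNorm (w : ℝ → ℝ) : ℝ := (eLpNorm w ⊤ volume).toReal

/-- The primitive `v₀(x) = ∫₀ˣ u₀` of `u₀`. -/
def primitive (u₀ : ℝ → ℝ) (x : ℝ) : ℝ := ∫ s in (0 : ℝ)..x, u₀ s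

/-- The least Lipschitz constant of a Lipschitz function `g : ℝ → ℝ`. -/
def lipConst (g : ℝ → ℝ) : ℝ :=
  sInf {K : ℝ | 0 ≤ K ∧ ∀ x y : ℝ, |g x - g y| ≤ K * |x - y|}

/-- The Fenchel dual `f*(q) = sup_p (p q - f(p))`, with values in `(-∞, +∞]`
(it is finite everywhere when `f` is superlinear). -/
def fenchel (f : ℝ → ℝ) (q : ℝ) : EReal := ⨆ p : ℝ, ((p * q - f p : ℝ) : EReal)

/-- The Hopf–Lax infimum `inf_y { w(y) + h f*((x - y)/h) }` after a time step `h > 0`,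
starting from the function `w`. -/
def hopfLax (f w : ℝ → ℝ) (x h : ℝ) : EReal :=
  ⨅ y : ℝ, (w y : EReal) + (h : EReal) * fenchel f ((x - y) / h)

/-- The value function `V(x,t)` with initial value `V(x,0) = v₀(x)`, as a real function;
that the infimum is finite for `t > 0` is part of the theorem. -/
def value (f u₀ : ℝ → ℝ) (x t : ℝ) : ℝ :=
  if 0 < t then (hopfLax f (primitive u₀) x t).toReal else primitive u₀ x

/-- The two-time value function
`V(x,s,t) = inf_y { V(y,s) + (t - s) f*((x - y)/(t - s)) }`, for `0 ≤ s < t`. -/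
def value₂ (f u₀ : ℝ → ℝ) (x s t : ℝ) : EReal :=
  hopfLax f (fun y => value f u₀ y s) x (t - s)

/-- The Lax–Oleinik function `u = ∂V/∂x`. -/
def laxOleinik (f u₀ : ℝ → ℝ) (x t : ℝ) : ℝ := deriv (fun z => value f u₀ z t) x

/-- The open half-plane `ℝ × (0,∞)`. -/
def upperHalf : Set (ℝ × ℝ) := {p | 0 < p.2}

/-- Viscosity solutions of `V_t + f(V_x) = 0` in `ℝ × (0,∞)`, `V(·,0) = v₀`: continuous functions
on `ℝ × [0,∞)`, tested from above and from below with `C¹` functions. -/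
structure IsViscositySolution (f v₀ : ℝ → ℝ) (V : ℝ → ℝ → ℝ) : Prop where
  continuousOn : ContinuousOn (fun p : ℝ × ℝ => V p.1 p.2) {p | 0 ≤ p.2}
  initial : ∀ x, V x 0 = v₀ x
  subsolution : ∀ φ : ℝ × ℝ → ℝ, ContDiffOn ℝ 1 φ upperHalf → ∀ p ∈ upperHalf,
    IsLocalMax (fun q : ℝ × ℝ => V q.1 q.2 - φ q) p →
      fderiv ℝ φ p (0, 1) + f (fderiv ℝ φ p (1, 0)) ≤ 0
  supersolution : ∀ φ : ℝ × ℝ → ℝ, ContDiffOn ℝ 1 φ upperHalf → ∀ p ∈ upperHalf,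
    IsLocalMin (fun q : ℝ × ℝ => V q.1 q.2 - φ q) p →
      0 ≤ fderiv ℝ φ p (0, 1) + f (fderiv ℝ φ p (1, 0))

/-- Bounded weak solutions of `u_t + f(u)_x = 0` in `ℝ × (0,∞)`, `u(·,0) = u₀`.
The test functions in `C_c^∞(ℝ × [0,∞))` are the restrictions of those in `C_c^∞(ℝ × ℝ)`. -/
structure IsWeakSolution (f u₀ : ℝ → ℝ) (u : ℝ → ℝ → ℝ) : Prop where
  memLp : MemLp (fun p : ℝ × ℝ => u p.1 p.2) ⊤ (volume.restrict upperHalf)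
  weak : ∀ φ : ℝ × ℝ → ℝ, ContDiff ℝ ((⊤ : ℕ∞) : WithTop ℕ∞) φ → HasCompactSupport φ →
    (∫ p in upperHalf, (u p.1 p.2 * fderiv ℝ φ p (0, 1) + f (u p.1 p.2) * fderiv ℝ φ p (1, 0)))
      + ∫ x : ℝ, u₀ x * φ (x, 0) = 0

/-- `L = lim_{ε → 0+} ess sup { |f'(p)| : |p| ≤ M + ε }`. -/
def IsMaxSpeed (f : ℝ → ℝ) (M L : ℝ) : Prop :=
  0 ≤ L ∧ Tendsto
    (fun ε : ℝ => eLpNorm (deriv f) ⊤ (volume.restrict (Icc (-(M + ε)) (M + ε))))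
    (𝓝[>] 0) (𝓝 (ENNReal.ofReal L))

end LaxOleinik

end

/-!
The proof replaces the possibly infinite dual `f*` by a finite convex function. If `v₀` is
`M`-Lipschitz, let `g(q) = sup_{|p| ≤ M} (p q - f(p))` be the dual of `f` restricted to `[-M, M]`, and
let `α`, `β` be subgradients of `f` at `-M` and `M`. Then `g = f*` on `[α, β]`, `g ≤ f*` everywhere,
and outside `[α, β]` both functions grow at least with slope `M`, so that speeds outside `[α, β]`
cannot lower the Hopf–Lax infimum (`exists_optimal`). Hence the infimum with `f*` equals the infimum
with `g`, and it is attained at a speed in `[α, β]` (`hopfLax_eq_evolution`, `exists_evolution_eq`).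

Finiteness and the Lipschitz bounds follow, and convexity of `g` gives the semigroup property
(`evolution_evolution`). Following the semigroup backward for a short time, at an arbitrary speed and
at the optimal one, gives the two viscosity inequalities (`subsolution_of_isLocalMax`,
`supersolution_of_isLocalMin`). At the points where `V` is differentiable, which are almost all by
Rademacher's theorem, the equation `V_t + f(V_x) = 0` therefore holds. The weak formulation is
then the identity `∫ (V_x φ_t - V_t φ_x) = 0` on the whole plane, with `V(x,t) = v₀(x)` for `t < 0`:
the lower half-plane contributes the initial term (`isWeakSolution_laxOleinik`).

The `L¹` contraction needs no entropy argument. If `w - v` is nondecreasing, so is the difference of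
the evolutions of `w` and `v` (`monotone_evolution_sub`, by exchanging the feet of optimal rays
that cross), and its increment over `[a, b]` is at most that of `w - v` over `[a - L t, b + L t]`,
because optimal rays have speed at most `L` (`evolution_sub_increment_le`). Applying this to the
primitive of `max(u₁₀, u₂₀)` against those of `u₁₀` and `u₂₀` gives the contraction
(`integral_abs_laxOleinik_sub_le`).
-/

namespace LaxOleinik

/-! ### Subgradients and the truncated Fenchel dual -/

/-- `q` is a subgradient of `f` at `p`. -/
def IsSubgradient (f : ℝ → ℝ) (p q : ℝ) : Prop := ∀ y, f p + q * (y - p) ≤ f y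

lemma exists_isSubgradient {f : ℝ → ℝ} (hf : ConvexOn ℝ univ f) (p : ℝ) :
    ∃ q, IsSubgradient f p q := by
  refine ⟨derivWithin f (Ioi p) p, fun y => ?_⟩
  have hp : p ∈ interior (univ : Set ℝ) := by simp
  rcases lt_trichotomy y p with h | rfl | h
  · have h1 := (hf.slope_le_leftDeriv_of_mem_interior (mem_univ y) hp h).trans
      (hf.leftDeriv_le_rightDeriv_of_mem_interior hp)
    rw [slope_def_field, div_le_iff₀ (by linarith)] at h1
    linarith
  · simp
  · have h1 := hf.rightDeriv_le_slope_of_mem_interior hp (mem_univ y) h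
    rw [slope_def_field, le_div_iff₀ (by linarith)] at h1
    linarith

lemma IsSubgradient.mono {f : ℝ → ℝ} {p p' q q' : ℝ} (h : IsSubgradient f p q)
    (h' : IsSubgradient f p' q') (hp : p < p') : q ≤ q' := by
  have h1 := h p'
  have h2 := h' p
  have h3 : (q - q') * (p' - p) ≤ 0 := by linarith
  nlinarith

lemma isSubgradient_deriv {f : ℝ → ℝ} (hf : ConvexOn ℝ univ f) {p : ℝ}
    (hp : DifferentiableAt ℝ f p) : IsSubgradient f p (deriv f p) := by
  intro y
  rcases lt_trichotomy y p with h | rfl | h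
  · have h1 := hf.slope_le_deriv (mem_univ y) (mem_univ p) h hp
    rw [slope_def_field, div_le_iff₀ (by linarith)] at h1
    linarith
  · simp
  · have h1 := hf.deriv_le_slope (mem_univ p) (mem_univ y) h hp
    rw [slope_def_field, le_div_iff₀ (by linarith)] at h1
    linarith

/-- The Fenchel dual of the restriction of `f` to `[-M, M]`. Unlike `f*` it is real-valued. -/
noncomputable def truncatedDual (f : ℝ → ℝ) (M q : ℝ) : ℝ :=
  sSup ((fun p => p * q - f p) '' Icc (-M) M)

/-- A convex function `g : ℝ → ℝ` whose graph lies above the line of slope `M` through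
`(β, g β)` and above the line of slope `-M` through `(α, g α)`. For `M`-Lipschitz initial values,
only the speeds in `[α, β]` matter in the Hopf–Lax formula with such a Lagrangian `g`. -/
structure IsLagrangian (g : ℝ → ℝ) (M α β : ℝ) : Prop where
  nonneg : 0 ≤ M
  le : α ≤ β
  convex : ConvexOn ℝ univ g
  right : ∀ q, g β + M * (q - β) ≤ g q
  left : ∀ q, g α + M * (α - q) ≤ g q

/-- `g` is below the Fenchel dual of `f` everywhere, and equal to it on `[α, β]`. Both relations are
expressed without `f*`, which may be infinite. -/
structure IsDualOn (f g : ℝ → ℝ) (α β : ℝ) : Prop where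
  le_of_bound : ∀ q B, (∀ p, p * q - f p ≤ B) → g q ≤ B
  ge_on : ∀ q ∈ Icc α β, ∀ p, p * q - f p ≤ g q

section truncatedDual

variable {f : ℝ → ℝ} {M : ℝ}

lemma exists_truncatedDual_eq (hf : ConvexOn ℝ univ f) (hM : 0 ≤ M) (q : ℝ) :
    ∃ p ∈ Icc (-M) M, truncatedDual f M q = p * q - f p ∧
      ∀ p' ∈ Icc (-M) M, p' * q - f p' ≤ truncatedDual f M q := by
  have hc : ContinuousOn (fun p => p * q - f p) (Icc (-M) M) := by
    have := (hf.continuousOn isOpen_univ).mono (subset_univ (Icc (-M) M))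
    fun_prop
  obtain ⟨p, hp, hmax⟩ := isCompact_Icc.exists_isMaxOn ⟨0, by constructor <;> linarith⟩ hc
  have : truncatedDual f M q = p * q - f p := by
    refine IsGreatest.csSup_eq ⟨mem_image_of_mem _ hp, ?_⟩
    rintro _ ⟨p', hp', rfl⟩
    exact hmax hp'
  exact ⟨p, hp, this, fun p' hp' => this ▸ hmax hp'⟩

lemma convexOn_truncatedDual (hf : ConvexOn ℝ univ f) (hM : 0 ≤ M) :
    ConvexOn ℝ univ (truncatedDual f M) := by
  refine ⟨convex_univ, fun x _ y _ a b ha hb hab => ?_⟩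
  simp only [smul_eq_mul]
  obtain ⟨p, hp, h, -⟩ := exists_truncatedDual_eq hf hM (a * x + b * y)
  obtain ⟨-, -, -, hx⟩ := exists_truncatedDual_eq hf hM x
  obtain ⟨-, -, -, hy⟩ := exists_truncatedDual_eq hf hM y
  rw [h]
  have h1 := mul_le_mul_of_nonneg_left (hx p hp) ha
  have h2 := mul_le_mul_of_nonneg_left (hy p hp) hb
  have h3 : f p = a * f p + b * f p := by rw [← add_mul, hab, one_mul]
  linarith

lemma isLagrangian_truncatedDual (hf : ConvexOn ℝ univ f) (hM : 0 ≤ M) {α β : ℝ} (hαβ : α ≤ β)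
    (hα : IsSubgradient f (-M) α) (hβ : IsSubgradient f M β) :
    IsLagrangian (truncatedDual f M) M α β := by
  have key : ∀ p₀ q₀, IsSubgradient f p₀ q₀ → p₀ ∈ Icc (-M) M → ∀ q,
      truncatedDual f M q₀ + p₀ * (q - q₀) ≤ truncatedDual f M q := by
    intro p₀ q₀ h hp₀ q
    obtain ⟨p, -, hp, -⟩ := exists_truncatedDual_eq hf hM q₀
    obtain ⟨-, -, -, hq⟩ := exists_truncatedDual_eq hf hM q
    have h1 := hq p₀ hp₀
    have h2 := h p
    rw [hp]
    linarith
  refine ⟨hM, hαβ, convexOn_truncatedDual hf hM, key M β hβ ⟨by linarith, le_rfl⟩, fun q => ?_⟩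
  have := key (-M) α hα ⟨le_rfl, by linarith⟩ q
  linarith

lemma isDualOn_truncatedDual (hf : ConvexOn ℝ univ f) (hM : 0 ≤ M) {α β : ℝ}
    (hα : IsSubgradient f (-M) α) (hβ : IsSubgradient f M β) :
    IsDualOn f (truncatedDual f M) α β := by
  constructor
  · intro q B hB
    obtain ⟨p, -, hp, -⟩ := exists_truncatedDual_eq hf hM q
    exact hp ▸ hB p
  · intro q hq p
    obtain ⟨-, -, -, h⟩ := exists_truncatedDual_eq hf hM q
    rcases lt_or_ge p (-M) with hp | hp
    · have h1 := h (-M) ⟨le_rfl, by linarith⟩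
      have h2 := hα p
      have h3 : 0 ≤ (q - α) * (-M - p) := mul_nonneg (by linarith [hq.1]) (by linarith)
      linarith
    rcases lt_or_ge M p with hp' | hp'
    · have h1 := h M ⟨by linarith, le_rfl⟩
      have h2 := hβ p
      have h3 : 0 ≤ (β - q) * (p - M) := mul_nonneg (by linarith [hq.2]) (by linarith)
      linarith
    · exact h p ⟨hp, hp'⟩

/-- For `M = 0` two arbitrary subgradients at `±M` may be in the wrong order. -/
lemma exists_ordered_subgradients (hf : ConvexOn ℝ univ f) (hM : 0 ≤ M) :
    ∃ α β, α ≤ β ∧ IsSubgradient f (-M) α ∧ IsSubgradient f M β := by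
  obtain ⟨β, hβ⟩ := exists_isSubgradient hf M
  rcases hM.eq_or_lt with rfl | hM
  · exact ⟨β, β, le_rfl, by simpa using hβ, hβ⟩
  · obtain ⟨α, hα⟩ := exists_isSubgradient hf (-M)
    exact ⟨α, β, hα.mono hβ (by linarith), hα, hβ⟩

lemma exists_lagrangian (hf : ConvexOn ℝ univ f) (hM : 0 ≤ M) :
    ∃ g α β, IsLagrangian g M α β ∧ IsDualOn f g α β := by
  obtain ⟨α, β, hαβ, hα, hβ⟩ := exists_ordered_subgradients hf hM
  exact ⟨_, α, β, isLagrangian_truncatedDual hf hM hαβ hα hβ, isDualOn_truncatedDual hf hM hα hβ⟩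

end truncatedDual

/-! ### The Hopf–Lax semigroup of a real-valued Lagrangian -/

/-- The Hopf–Lax evolution of `w` up to time `t`, with the infimum taken over the speeds
`q = (x - y) / t` instead of the starting points `y`. At `t = 0` it returns `w`. -/
noncomputable def evolution (g w : ℝ → ℝ) (x t : ℝ) : ℝ := ⨅ q, (w (x - t * q) + t * g q)

section evolution

variable {g w : ℝ → ℝ} {M α β : ℝ}

lemma continuous_of_abs_sub_le (hw : ∀ x y, |w x - w y| ≤ M * |x - y|) : Continuous w :=
  (LipschitzWith.of_dist_le_mul (K := M.toNNReal) fun x y => by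
    rw [Real.dist_eq, Real.dist_eq]
    exact (hw x y).trans (mul_le_mul_of_nonneg_right (Real.le_coe_toNNReal M)
      (abs_nonneg _))).continuous

/-- The infimum is attained at a speed in `[α, β]`: the linear growth of `g` outside `[α, β]`
outweighs the variation of `w`. -/
lemma exists_optimal (hg : IsLagrangian g M α β) (hw : ∀ x y, |w x - w y| ≤ M * |x - y|)
    (x : ℝ) {t : ℝ} (ht : 0 ≤ t) :
    ∃ q ∈ Icc α β, ∀ q', w (x - t * q) + t * g q ≤ w (x - t * q') + t * g q' := by
  have hgc : Continuous g := by
    rw [← continuousOn_univ]; exact hg.convex.continuousOn isOpen_univ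
  have hwc := continuous_of_abs_sub_le hw
  have hc : ContinuousOn (fun q => w (x - t * q) + t * g q) (Icc α β) := by fun_prop
  obtain ⟨q, hq, hmin⟩ := isCompact_Icc.exists_isMinOn ⟨α, le_rfl, hg.le⟩ hc
  refine ⟨q, hq, fun q' => ?_⟩
  rcases lt_or_ge q' α with h | h
  · have h1 : w (x - t * q) + t * g q ≤ w (x - t * α) + t * g α := hmin ⟨le_rfl, hg.le⟩
    have h2 := hw (x - t * α) (x - t * q')
    rw [show x - t * α - (x - t * q') = -(t * (α - q')) by ring, abs_neg,
      abs_of_nonneg (mul_nonneg ht (by linarith))] at h2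
    have h3 := mul_le_mul_of_nonneg_left (hg.left q') ht
    linarith [le_abs_self (w (x - t * α) - w (x - t * q'))]
  rcases lt_or_ge β q' with h' | h'
  · have h1 : w (x - t * q) + t * g q ≤ w (x - t * β) + t * g β := hmin ⟨hg.le, le_rfl⟩
    have h2 := hw (x - t * β) (x - t * q')
    rw [show x - t * β - (x - t * q') = t * (q' - β) by ring,
      abs_of_nonneg (mul_nonneg ht (by linarith))] at h2
    have h3 := mul_le_mul_of_nonneg_left (hg.right q') ht
    linarith [le_abs_self (w (x - t * β) - w (x - t * q'))]
  · exact hmin ⟨h, h'⟩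

lemma exists_evolution_eq (hg : IsLagrangian g M α β) (hw : ∀ x y, |w x - w y| ≤ M * |x - y|)
    (x : ℝ) {t : ℝ} (ht : 0 ≤ t) :
    ∃ q ∈ Icc α β, evolution g w x t = w (x - t * q) + t * g q := by
  obtain ⟨q, hq, hmin⟩ := exists_optimal hg hw x ht
  refine ⟨q, hq, le_antisymm (ciInf_le ⟨w (x - t * q) + t * g q, ?_⟩ q) (le_ciInf hmin)⟩
  rintro _ ⟨q', rfl⟩
  exact hmin q'

lemma evolution_le (hg : IsLagrangian g M α β) (hw : ∀ x y, |w x - w y| ≤ M * |x - y|)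
    (x : ℝ) {t : ℝ} (ht : 0 ≤ t) (q : ℝ) :
    evolution g w x t ≤ w (x - t * q) + t * g q := by
  obtain ⟨q₀, -, hmin⟩ := exists_optimal hg hw x ht
  refine ciInf_le ⟨w (x - t * q₀) + t * g q₀, ?_⟩ q
  rintro _ ⟨q', rfl⟩
  exact hmin q'

@[simp] lemma evolution_zero (x : ℝ) : evolution g w x 0 = w x := by simp [evolution]

lemma abs_evolution_sub_le (hg : IsLagrangian g M α β) {K : ℝ} (hKM : K ≤ M)
    (hw : ∀ x y, |w x - w y| ≤ K * |x - y|) {t : ℝ} (ht : 0 ≤ t) (x y : ℝ) :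
    |evolution g w x t - evolution g w y t| ≤ K * |x - y| := by
  have hw' : ∀ x y, |w x - w y| ≤ M * |x - y| := fun x y =>
    (hw x y).trans (mul_le_mul_of_nonneg_right hKM (abs_nonneg _))
  have key : ∀ x y, evolution g w x t - evolution g w y t ≤ K * |x - y| := by
    intro x y
    obtain ⟨q, -, hq⟩ := exists_evolution_eq hg hw' y ht
    have h1 := evolution_le hg hw' x ht q
    have h2 := hw (x - t * q) (y - t * q)
    rw [show x - t * q - (y - t * q) = x - y by ring] at h2
    linarith [le_abs_self (w (x - t * q) - w (y - t * q))]
  refine abs_sub_le_iff.2 ⟨key x y, ?_⟩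
  rw [abs_sub_comm]
  exact key y x

/-- The semigroup property. It rests on convexity of `g`: running first with speed `q'` and then
with speed `q` costs at least as much as running with the average speed. -/
lemma evolution_evolution (hg : IsLagrangian g M α β) (hw : ∀ x y, |w x - w y| ≤ M * |x - y|)
    {s h : ℝ} (hs : 0 ≤ s) (hh : 0 ≤ h) (x : ℝ) :
    evolution g (fun y => evolution g w y s) x h = evolution g w x (s + h) := by
  have hw' := abs_evolution_sub_le hg le_rfl hw hs
  rcases (add_nonneg hs hh).eq_or_lt with h0 | h0
  · obtain rfl : s = 0 := by linarith
    obtain rfl : h = 0 := by linarith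
    simp
  apply le_antisymm
  · obtain ⟨q, -, hq⟩ := exists_evolution_eq hg hw x h0.le
    have h1 := evolution_le hg hw' x hh q
    have h2 := evolution_le hg hw (x - h * q) hs q
    rw [show x - h * q - s * q = x - (s + h) * q by ring] at h2
    linarith
  · obtain ⟨q, -, hq⟩ := exists_evolution_eq hg hw' x hh
    obtain ⟨q', -, hq'⟩ := exists_evolution_eq hg hw (x - h * q) hs
    have h1 := evolution_le hg hw x h0.le (h / (s + h) * q + s / (s + h) * q')
    have h2 := hg.convex.2 (mem_univ q) (mem_univ q') (div_nonneg hh h0.le) (div_nonneg hs h0.le)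
      (by field_simp; ring)
    simp only [smul_eq_mul] at h2
    have h3 := mul_le_mul_of_nonneg_left h2 h0.le
    rw [show (s + h) * (h / (s + h) * g q + s / (s + h) * g q') = h * g q + s * g q' by
      field_simp] at h3
    rw [show x - (s + h) * (h / (s + h) * q + s / (s + h) * q') = x - h * q - s * q' by
      field_simp; ring] at h1
    linarith

lemma abs_evolution_sub_self_le (hg : IsLagrangian g M α β)
    (hw : ∀ x y, |w x - w y| ≤ M * |x - y|) {h : ℝ} (hh : 0 ≤ h) (x : ℝ) :
    |evolution g w x h - w x| ≤ (|g 0| + |g α + M * α| + |g β - M * β|) * h := by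
  rw [abs_sub_le_iff]
  have e0 := le_abs_self (g 0)
  have e1 := neg_abs_le (g α + M * α)
  have e2 := neg_abs_le (g β - M * β)
  constructor
  · have h1 := evolution_le hg hw x hh 0
    rw [mul_zero, sub_zero] at h1
    have : h * g 0 ≤ (|g 0| + |g α + M * α| + |g β - M * β|) * h := by
      rw [mul_comm]
      exact mul_le_mul_of_nonneg_right
        (by linarith [abs_nonneg (g α + M * α), abs_nonneg (g β - M * β)]) hh
    linarith
  · obtain ⟨q, -, hq⟩ := exists_evolution_eq hg hw x hh
    have h1 := hw x (x - h * q)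
    rw [show x - (x - h * q) = h * q by ring, abs_mul, abs_of_nonneg hh] at h1
    have h2 : M * |q| - g q ≤ |g 0| + |g α + M * α| + |g β - M * β| := by
      have h3 := hg.left q
      have h4 := hg.right q
      rcases abs_cases q with ⟨hq, -⟩ | ⟨hq, -⟩ <;> rw [hq] <;>
        linarith [abs_nonneg (g 0), abs_nonneg (g α + M * α), abs_nonneg (g β - M * β)]
    have h3 := mul_le_mul_of_nonneg_right h2 hh
    linarith [le_abs_self (w x - w (x - h * q))]

/-- Lipschitz continuity in both variables, from the semigroup property and the estimate for a
single short step. -/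
lemma abs_evolution_sub_evolution_le (hg : IsLagrangian g M α β) {K : ℝ} (hKM : K ≤ M)
    (hw : ∀ x y, |w x - w y| ≤ K * |x - y|) {s t : ℝ} (hs : 0 ≤ s) (ht : 0 ≤ t) (x y : ℝ) :
    |evolution g w x t - evolution g w y s| ≤
      K * |x - y| + (|g 0| + |g α + M * α| + |g β - M * β|) * |t - s| := by
  have hw' : ∀ x y, |w x - w y| ≤ M * |x - y| := fun x y =>
    (hw x y).trans (mul_le_mul_of_nonneg_right hKM (abs_nonneg _))
  have key : ∀ s t, 0 ≤ s → s ≤ t → ∀ x, |evolution g w x t - evolution g w x s| ≤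
      (|g 0| + |g α + M * α| + |g β - M * β|) * |t - s| := by
    intro s t hs hst x
    have h1 := evolution_evolution hg hw' hs (sub_nonneg.2 hst) x
    rw [add_sub_cancel] at h1
    rw [← h1, abs_of_nonneg (sub_nonneg.2 hst)]
    exact abs_evolution_sub_self_le hg (abs_evolution_sub_le hg le_rfl hw' hs)
      (sub_nonneg.2 hst) x
  have h1 : |evolution g w y t - evolution g w y s| ≤
      (|g 0| + |g α + M * α| + |g β - M * β|) * |t - s| := by
    rcases le_total s t with h | h
    · exact key s t hs h y
    · rw [abs_sub_comm, abs_sub_comm t]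
      exact key t s ht h y
  have h2 := abs_evolution_sub_le hg hKM hw ht x y
  have h3 := abs_sub_le (evolution g w x t) (evolution g w y t) (evolution g w y s)
  linarith

/-- The Hopf–Lax infimum with the possibly infinite dual `f*` is the evolution with `g`. -/
lemma hopfLax_eq_evolution {f : ℝ → ℝ} (hg : IsLagrangian g M α β) (hfg : IsDualOn f g α β)
    (hw : ∀ x y, |w x - w y| ≤ M * |x - y|) (x : ℝ) {h : ℝ} (hh : 0 < h) :
    hopfLax f w x h = (evolution g w x h : EReal) := by
  apply le_antisymm
  · obtain ⟨q, hq, he⟩ := exists_evolution_eq hg hw x hh.le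
    refine (iInf_le _ (x - h * q)).trans ?_
    rw [he, show (x - (x - h * q)) / h = q by field_simp; ring, EReal.coe_add, EReal.coe_mul]
    gcongr
    exact iSup_le fun p => EReal.coe_le_coe_iff.2 (hfg.ge_on q hq p)
  · refine le_iInf fun y => ?_
    have h1 := evolution_le hg hw x hh.le ((x - y) / h)
    rw [show x - h * ((x - y) / h) = y by field_simp; ring] at h1
    refine (EReal.coe_le_coe_iff.2 h1).trans ?_
    rw [EReal.coe_add, EReal.coe_mul]
    gcongr
    -- Every real number above `f*((x - y)/h)` bounds `g((x - y)/h)`.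
    refine EReal.le_of_forall_lt_iff_le.1 fun B hB => ?_
    refine EReal.coe_le_coe_iff.2 (hfg.le_of_bound _ B fun p => ?_)
    exact EReal.coe_le_coe_iff.1 ((le_iSup (fun p : ℝ => ((p * ((x - y) / h) - f p : ℝ) : EReal))
      p).trans hB.le)

end evolution

/-! ### The Hamilton–Jacobi equation -/

section viscosity

variable {f g w : ℝ → ℝ} {M α β : ℝ}

/-- A property that holds near `(x, t)` holds, uniformly over bounded speeds `q`, along the backward
rays `h ↦ (x - h q, t - h)` for small `h > 0`. -/
lemma eventually_backward {P : ℝ × ℝ → Prop} {x t : ℝ} (hP : ∀ᶠ y in 𝓝 (x, t), P y) (B : ℝ) :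
    ∀ᶠ h in 𝓝[>] (0 : ℝ), ∀ q, |q| ≤ B → P (x - h * q, t - h) := by
  obtain ⟨ε, hε, hball⟩ := Metric.eventually_nhds_iff.1 hP
  have hB : 0 < |B| + 1 := by positivity
  have : Ioo (0 : ℝ) (ε / (|B| + 1)) ∈ 𝓝[>] (0 : ℝ) := Ioo_mem_nhdsGT (by positivity)
  filter_upwards [this] with h hh q hq
  apply hball
  have h1 := (lt_div_iff₀ hB).1 hh.2
  rw [Prod.dist_eq, Real.dist_eq, Real.dist_eq, max_lt_iff]
  have hh0 := hh.1
  constructor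
  · rw [show x - h * q - x = -(h * q) by ring, abs_neg, abs_mul, abs_of_pos hh0]
    nlinarith [le_abs_self B]
  · rw [show t - h - t = -h by ring, abs_neg, abs_of_pos hh0]
    nlinarith [abs_nonneg B]

lemma eventually_backward_linearization {φ : ℝ × ℝ → ℝ} {x t : ℝ}
    (hφ : DifferentiableAt ℝ φ (x, t)) (B : ℝ) {ε : ℝ} (hε : 0 < ε) :
    ∀ᶠ h in 𝓝[>] (0 : ℝ), ∀ q, |q| ≤ B →
      |φ (x, t) - φ (x - h * q, t - h) -
        h * (q * fderiv ℝ φ (x, t) (1, 0) + fderiv ℝ φ (x, t) (0, 1))| ≤ ε * h := by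
  have hB : 0 < |B| + 1 := by positivity
  have h1 := hφ.hasFDerivAt.isLittleO.def (div_pos hε hB)
  filter_upwards [eventually_backward h1 B, self_mem_nhdsWithin] with h hh (hh0 : 0 < h) q hq
  have h2 := hh q hq
  have h3 : ((x - h * q, t - h) : ℝ × ℝ) - (x, t) = -(h • (q • (1, 0) + (0, 1))) := by
    ext <;> simp
  rw [h3, map_neg, map_smul, map_add, map_smul, norm_neg, norm_smul, Real.norm_eq_abs,
    Real.norm_eq_abs, abs_of_pos hh0] at h2
  have h4 : ‖q • ((1 : ℝ), (0 : ℝ)) + ((0 : ℝ), (1 : ℝ))‖ ≤ |B| + 1 := by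
    simp only [Prod.norm_def]
    simp only [Prod.smul_mk, smul_eq_mul, mul_one, mul_zero, Prod.mk_add_mk, add_zero, zero_add,
      Real.norm_eq_abs, abs_one]
    exact max_le (by linarith [le_abs_self B]) (by linarith [abs_nonneg B])
  have h5 : ε / (|B| + 1) * (h * ‖q • ((1 : ℝ), (0 : ℝ)) + ((0 : ℝ), (1 : ℝ))‖) ≤ ε * h := by
    calc _ ≤ ε / (|B| + 1) * (h * (|B| + 1)) := by gcongr
      _ = ε * h := by field_simp
  refine le_trans (le_of_eq ?_) (h2.trans h5)
  rw [← abs_neg]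
  congr 1
  simp only [smul_eq_mul]
  ring

/-- Going backward at any speed `q` gives `φ_t + q φ_x ≤ g q`; a subgradient `q` of `f` at `φ_x`
turns this into the equation for `f`. -/
lemma subsolution_of_isLocalMax (hf : ConvexOn ℝ univ f) (hg : IsLagrangian g M α β)
    (hfg : IsDualOn f g α β) (hw : ∀ x y, |w x - w y| ≤ M * |x - y|) {φ : ℝ × ℝ → ℝ} {x t : ℝ}
    (ht : 0 < t) (hφ : DifferentiableAt ℝ φ (x, t))
    (hmax : IsLocalMax (fun p : ℝ × ℝ => evolution g w p.1 p.2 - φ p) (x, t)) :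
    fderiv ℝ φ (x, t) (0, 1) + f (fderiv ℝ φ (x, t) (1, 0)) ≤ 0 := by
  obtain ⟨q, hq⟩ := exists_isSubgradient hf (fderiv ℝ φ (x, t) (1, 0))
  have hgq := hfg.le_of_bound q (fderiv ℝ φ (x, t) (1, 0) * q - f (fderiv ℝ φ (x, t) (1, 0)))
    fun p => by linarith [hq p]
  refine le_of_forall_pos_le_add fun ε hε => ?_
  obtain ⟨h, h1, h2, hh, hht⟩ := ((eventually_backward_linearization hφ |q| hε).and
    ((eventually_backward hmax |q|).and (Ioo_mem_nhdsGT ht))).exists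
  replace h1 := abs_le.1 (h1 q le_rfl)
  replace h2 := h2 q le_rfl
  have h3 := evolution_le hg (abs_evolution_sub_le hg le_rfl hw (sub_nonneg.2 hht.le)) x hh.le q
  rw [evolution_evolution hg hw (sub_nonneg.2 hht.le) hh.le, sub_add_cancel] at h3
  simp only at h2
  have h4 : h * (q * fderiv ℝ φ (x, t) (1, 0) + fderiv ℝ φ (x, t) (0, 1)) - ε * h ≤ h * g q := by
    linarith [h1.1]
  have h5 : q * fderiv ℝ φ (x, t) (1, 0) + fderiv ℝ φ (x, t) (0, 1) - ε ≤ g q :=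
    le_of_mul_le_mul_left (by linarith) hh
  linarith

/-- Going backward at the optimal speeds, which stay in `[α, β]`, where `g` is the dual of `f`. -/
lemma supersolution_of_isLocalMin (hg : IsLagrangian g M α β)
    (hfg : IsDualOn f g α β) (hw : ∀ x y, |w x - w y| ≤ M * |x - y|) {φ : ℝ × ℝ → ℝ} {x t : ℝ}
    (ht : 0 < t) (hφ : DifferentiableAt ℝ φ (x, t))
    (hmin : IsLocalMin (fun p : ℝ × ℝ => evolution g w p.1 p.2 - φ p) (x, t)) :
    0 ≤ fderiv ℝ φ (x, t) (0, 1) + f (fderiv ℝ φ (x, t) (1, 0)) := by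
  refine le_of_forall_pos_le_add fun ε hε => ?_
  obtain ⟨h, h1, h2, hh, hht⟩ := ((eventually_backward_linearization hφ (max |α| |β|) hε).and
    ((eventually_backward hmin (max |α| |β|)).and (Ioo_mem_nhdsGT ht))).exists
  obtain ⟨q, hq, h3⟩ :=
    exists_evolution_eq hg (abs_evolution_sub_le hg le_rfl hw (sub_nonneg.2 hht.le)) x hh.le
  have hqB : |q| ≤ max |α| |β| := abs_le_max_abs_abs hq.1 hq.2
  replace h1 := abs_le.1 (h1 q hqB)
  replace h2 := h2 q hqB
  rw [evolution_evolution hg hw (sub_nonneg.2 hht.le) hh.le, sub_add_cancel] at h3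
  simp only at h2
  have hgq := hfg.ge_on q hq (fderiv ℝ φ (x, t) (1, 0))
  have h4 : h * g q ≤ h * (q * fderiv ℝ φ (x, t) (1, 0) + fderiv ℝ φ (x, t) (0, 1)) + ε * h := by
    linarith [h1.2]
  have h5 : g q ≤ q * fderiv ℝ φ (x, t) (1, 0) + fderiv ℝ φ (x, t) (0, 1) + ε :=
    le_of_mul_le_mul_left (by linarith) hh
  linarith

end viscosity

/-! ### The primitive and the value function -/

section value

variable {f g u₀ : ℝ → ℝ} {M α β : ℝ}

lemma ae_abs_le_supNorm (hu : MemLp u₀ ⊤ volume) : ∀ᵐ x, |u₀ x| ≤ supNorm u₀ := by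
  have h := ae_le_eLpNormEssSup (f := u₀) (μ := volume)
  rw [← eLpNorm_exponent_top] at h
  filter_upwards [h] with x hx
  have := ENNReal.toReal_mono hu.eLpNorm_ne_top hx
  simpa [supNorm] using this

lemma supNorm_nonneg (u₀ : ℝ → ℝ) : 0 ≤ supNorm u₀ := ENNReal.toReal_nonneg

lemma locallyIntegrable_of_memLp_top (hu : MemLp u₀ ⊤ volume) : LocallyIntegrable u₀ volume :=
  hu.locallyIntegrable le_top

lemma intervalIntegrable_of_memLp_top (hu : MemLp u₀ ⊤ volume) (a b : ℝ) :
    IntervalIntegrable u₀ volume a b :=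
  ((locallyIntegrable_of_memLp_top hu).integrableOn_isCompact isCompact_uIcc).intervalIntegrable

lemma primitive_sub (hu : MemLp u₀ ⊤ volume) (a b : ℝ) :
    primitive u₀ b - primitive u₀ a = ∫ s in a..b, u₀ s :=
  intervalIntegral.integral_interval_sub_left (intervalIntegrable_of_memLp_top hu 0 b)
    (intervalIntegrable_of_memLp_top hu 0 a)

lemma abs_primitive_sub_le (hu : MemLp u₀ ⊤ volume) (x y : ℝ) :
    |primitive u₀ x - primitive u₀ y| ≤ supNorm u₀ * |x - y| := by
  rw [primitive_sub hu]
  refine intervalIntegral.norm_integral_le_of_norm_le_const_ae (f := u₀) ?_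
  filter_upwards [ae_abs_le_supNorm hu] with s hs _ using hs

lemma ae_deriv_primitive (hu : MemLp u₀ ⊤ volume) : ∀ᵐ x, deriv (primitive u₀) x = u₀ x := by
  filter_upwards [LocallyIntegrable.ae_hasDerivAt_integral (locallyIntegrable_of_memLp_top hu)] with x hx
  exact (hx 0).deriv

lemma lipConst_le {v : ℝ → ℝ} {K : ℝ} (hK : 0 ≤ K) (h : ∀ x y, |v x - v y| ≤ K * |x - y|) :
    lipConst v ≤ K :=
  csInf_le ⟨0, fun _ h => h.1⟩ ⟨hK, h⟩

/-- The infimum in the definition of the least Lipschitz constant is attained. -/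
lemma abs_sub_le_lipConst {v : ℝ → ℝ} {K : ℝ} (hK : 0 ≤ K)
    (h : ∀ x y, |v x - v y| ≤ K * |x - y|) (x y : ℝ) :
    |v x - v y| ≤ lipConst v * |x - y| := by
  rcases eq_or_ne x y with rfl | hxy
  · simp
  have hpos : 0 < |x - y| := abs_pos.2 (sub_ne_zero.2 hxy)
  rw [← div_le_iff₀ hpos]
  exact le_csInf ⟨K, hK, h⟩ fun K' hK' => (div_le_iff₀ hpos).2 (hK'.2 x y)

lemma lipConst_nonneg (v : ℝ → ℝ) : 0 ≤ lipConst v := Real.sInf_nonneg fun _ h => h.1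

lemma value_eq_evolution (hg : IsLagrangian g M α β) (hfg : IsDualOn f g α β)
    (hu : MemLp u₀ ⊤ volume) (hM : supNorm u₀ ≤ M) (x t : ℝ) :
    value f u₀ x t = evolution g (primitive u₀) x (max t 0) := by
  have hw : ∀ x y, |primitive u₀ x - primitive u₀ y| ≤ M * |x - y| := fun x y =>
    (abs_primitive_sub_le hu x y).trans (mul_le_mul_of_nonneg_right hM (abs_nonneg _))
  unfold value
  split_ifs with h
  · rw [hopfLax_eq_evolution hg hfg hw x h, EReal.toReal_coe, max_eq_left h.le]
  · rw [max_eq_right (not_lt.1 h), evolution_zero]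

/-- Below `t = 0` the function `value` is extended by its initial value, so that it is Lipschitz on
the whole plane. -/
lemma exists_lipschitzWith_value (hf : ConvexOn ℝ univ f) (hu : MemLp u₀ ⊤ volume) :
    ∃ C, LipschitzWith C (fun p : ℝ × ℝ => value f u₀ p.1 p.2) := by
  obtain ⟨g, α, β, hg, hfg⟩ := exists_lagrangian hf (supNorm_nonneg u₀)
  set M := supNorm u₀
  set C := |g 0| + |g α + M * α| + |g β - M * β| with hC_def
  have hC : 0 ≤ C := by positivity
  refine ⟨(M + C).toNNReal, LipschitzWith.of_dist_le_mul fun p q => ?_⟩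
  rw [Real.coe_toNNReal _ (add_nonneg hg.nonneg hC), Real.dist_eq,
    value_eq_evolution hg hfg hu le_rfl, value_eq_evolution hg hfg hu le_rfl]
  refine (abs_evolution_sub_evolution_le hg le_rfl (abs_primitive_sub_le hu)
    (le_max_right _ _) (le_max_right _ _) _ _).trans ?_
  rw [← hC_def, Prod.dist_eq, add_mul M C]
  have h1 : |max p.2 0 - max q.2 0| ≤ |p.2 - q.2| := abs_max_sub_max_le_abs _ _ _
  exact add_le_add (mul_le_mul_of_nonneg_left (le_max_left _ _) hg.nonneg)
    (mul_le_mul_of_nonneg_left (h1.trans (le_max_right _ _)) hC)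

lemma continuous_value (hf : ConvexOn ℝ univ f) (hu : MemLp u₀ ⊤ volume) :
    Continuous fun p : ℝ × ℝ => value f u₀ p.1 p.2 :=
  (exists_lipschitzWith_value hf hu).choose_spec.continuous

/-- The viscosity inequalities need differentiability of the test function only at the point of
contact. -/
lemma value_subsolution (hf : ConvexOn ℝ univ f) (hu : MemLp u₀ ⊤ volume) {φ : ℝ × ℝ → ℝ}
    {p : ℝ × ℝ} (hp : 0 < p.2) (hφ : DifferentiableAt ℝ φ p)
    (hmax : IsLocalMax (fun q : ℝ × ℝ => value f u₀ q.1 q.2 - φ q) p) :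
    fderiv ℝ φ p (0, 1) + f (fderiv ℝ φ p (1, 0)) ≤ 0 := by
  obtain ⟨g, α, β, hg, hfg⟩ := exists_lagrangian hf (supNorm_nonneg u₀)
  refine subsolution_of_isLocalMax hf hg hfg (abs_primitive_sub_le hu) hp hφ ?_
  have : ∀ᶠ q : ℝ × ℝ in 𝓝 p, 0 < q.2 := continuous_snd.continuousAt.eventually (lt_mem_nhds hp)
  filter_upwards [this, hmax] with q hq h
  rwa [value_eq_evolution hg hfg hu le_rfl, value_eq_evolution hg hfg hu le_rfl,
    max_eq_left hq.le, max_eq_left hp.le] at h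

lemma value_supersolution (hf : ConvexOn ℝ univ f) (hu : MemLp u₀ ⊤ volume) {φ : ℝ × ℝ → ℝ}
    {p : ℝ × ℝ} (hp : 0 < p.2) (hφ : DifferentiableAt ℝ φ p)
    (hmin : IsLocalMin (fun q : ℝ × ℝ => value f u₀ q.1 q.2 - φ q) p) :
    0 ≤ fderiv ℝ φ p (0, 1) + f (fderiv ℝ φ p (1, 0)) := by
  obtain ⟨g, α, β, hg, hfg⟩ := exists_lagrangian hf (supNorm_nonneg u₀)
  refine supersolution_of_isLocalMin hg hfg (abs_primitive_sub_le hu) hp hφ ?_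
  have : ∀ᶠ q : ℝ × ℝ in 𝓝 p, 0 < q.2 := continuous_snd.continuousAt.eventually (lt_mem_nhds hp)
  filter_upwards [this, hmin] with q hq h
  rwa [value_eq_evolution hg hfg hu le_rfl, value_eq_evolution hg hfg hu le_rfl,
    max_eq_left hq.le, max_eq_left hp.le] at h

lemma isViscositySolution_value (hf : ConvexOn ℝ univ f) (hu : MemLp u₀ ⊤ volume) :
    IsViscositySolution f (primitive u₀) (value f u₀) := by
  have hopen : IsOpen upperHalf := isOpen_lt continuous_const continuous_snd
  have hdiff : ∀ φ : ℝ × ℝ → ℝ, ContDiffOn ℝ 1 φ upperHalf → ∀ p ∈ upperHalf,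
      DifferentiableAt ℝ φ p := fun φ hφ p hp =>
    (hφ.contDiffAt (hopen.mem_nhds hp)).differentiableAt one_ne_zero
  exact ⟨(continuous_value hf hu).continuousOn, fun x => by simp [value],
    fun φ hφ p hp => value_subsolution hf hu hp (hdiff φ hφ p hp),
    fun φ hφ p hp => value_supersolution hf hu hp (hdiff φ hφ p hp)⟩

lemma abs_value_sub_le (hf : ConvexOn ℝ univ f) (hu : MemLp u₀ ⊤ volume) (x y t : ℝ) :
    |value f u₀ x t - value f u₀ y t| ≤ lipConst (primitive u₀) * |x - y| := by
  obtain ⟨g, α, β, hg, hfg⟩ := exists_lagrangian hf (supNorm_nonneg u₀)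
  rw [value_eq_evolution hg hfg hu le_rfl, value_eq_evolution hg hfg hu le_rfl]
  exact abs_evolution_sub_le hg (lipConst_le (supNorm_nonneg u₀) (abs_primitive_sub_le hu))
    (abs_sub_le_lipConst (supNorm_nonneg u₀) (abs_primitive_sub_le hu)) (le_max_right _ _) x y

lemma exists_abs_value_sub_value_le (hf : ConvexOn ℝ univ f) (hu : MemLp u₀ ⊤ volume) :
    ∃ C : ℝ, ∀ x y s t : ℝ, 0 ≤ s → 0 ≤ t → |value f u₀ x t - value f u₀ y s| ≤
      lipConst (primitive u₀) * |x - y| + C * |t - s| := by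
  obtain ⟨g, α, β, hg, hfg⟩ := exists_lagrangian hf (supNorm_nonneg u₀)
  refine ⟨|g 0| + |g α + supNorm u₀ * α| + |g β - supNorm u₀ * β|, fun x y s t hs ht => ?_⟩
  rw [value_eq_evolution hg hfg hu le_rfl, value_eq_evolution hg hfg hu le_rfl,
    max_eq_left hs, max_eq_left ht]
  exact abs_evolution_sub_evolution_le hg
    (lipConst_le (supNorm_nonneg u₀) (abs_primitive_sub_le hu))
    (abs_sub_le_lipConst (supNorm_nonneg u₀) (abs_primitive_sub_le hu)) hs ht x y

/-- The Hopf–Lax infimum started from `value` at time `s`; the case `s = 0` contains the finiteness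
of the infimum in the definition of `value`. -/
lemma value₂_eq_value (hf : ConvexOn ℝ univ f) (hu : MemLp u₀ ⊤ volume) {s t : ℝ} (hs : 0 ≤ s)
    (hst : s < t) (x : ℝ) : value₂ f u₀ x s t = ((value f u₀ x t : ℝ) : EReal) := by
  obtain ⟨g, α, β, hg, hfg⟩ := exists_lagrangian hf (supNorm_nonneg u₀)
  have hw := abs_primitive_sub_le hu
  unfold value₂
  simp_rw [value_eq_evolution hg hfg hu le_rfl, max_eq_left hs, max_eq_left (hs.trans hst.le)]
  rw [hopfLax_eq_evolution hg hfg (abs_evolution_sub_le hg le_rfl hw hs) x (sub_pos.2 hst),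
    evolution_evolution hg hw hs (sub_nonneg.2 hst.le), add_sub_cancel]

end value

/-! ### The spatial derivative as a weak solution -/

section weak

variable {f u₀ : ℝ → ℝ}

lemma lipschitzWith_value_slice (hf : ConvexOn ℝ univ f) (hu : MemLp u₀ ⊤ volume) (t : ℝ) :
    LipschitzWith (lipConst (primitive u₀)).toNNReal (fun x => value f u₀ x t) :=
  LipschitzWith.of_dist_le_mul fun x y => by
    rw [Real.coe_toNNReal _ (lipConst_nonneg _)]
    exact abs_value_sub_le hf hu x y t

lemma abs_laxOleinik_le (hf : ConvexOn ℝ univ f) (hu : MemLp u₀ ⊤ volume) (x t : ℝ) :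
    |laxOleinik f u₀ x t| ≤ supNorm u₀ := by
  have h := norm_deriv_le_of_lipschitz (x₀ := x) (lipschitzWith_value_slice hf hu t)
  rw [Real.coe_toNNReal _ (lipConst_nonneg _)] at h
  exact h.trans (lipConst_le (supNorm_nonneg u₀) (abs_primitive_sub_le hu))

lemma measurable_laxOleinik (hf : ConvexOn ℝ univ f) (hu : MemLp u₀ ⊤ volume) :
    Measurable (fun p : ℝ × ℝ => laxOleinik f u₀ p.1 p.2) := by
  have hc : Continuous (Function.uncurry fun t x : ℝ => value f u₀ x t) :=
    (continuous_value hf hu).comp continuous_swap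
  exact (measurable_deriv_with_param hc).comp measurable_swap

lemma memLp_laxOleinik (hf : ConvexOn ℝ univ f) (hu : MemLp u₀ ⊤ volume) :
    MemLp (fun p : ℝ × ℝ => laxOleinik f u₀ p.1 p.2) ⊤ (volume.restrict upperHalf) :=
  memLp_top_of_bound (measurable_laxOleinik hf hu).aestronglyMeasurable (supNorm u₀)
    (Eventually.of_forall fun p => abs_laxOleinik_le hf hu p.1 p.2)

lemma eLpNorm_laxOleinik_le (hf : ConvexOn ℝ univ f) (hu : MemLp u₀ ⊤ volume) :
    eLpNorm (fun p : ℝ × ℝ => laxOleinik f u₀ p.1 p.2) ⊤ (volume.restrict upperHalf) ≤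
      eLpNorm u₀ ⊤ volume := by
  rw [eLpNorm_exponent_top]
  refine eLpNormEssSup_le_of_ae_bound (C := supNorm u₀)
    (Eventually.of_forall fun p => abs_laxOleinik_le hf hu p.1 p.2) |>.trans ?_
  rw [supNorm, ENNReal.ofReal_toReal hu.eLpNorm_ne_top]

lemma lineDeriv_value_space (x t : ℝ) :
    lineDeriv ℝ (fun p : ℝ × ℝ => value f u₀ p.1 p.2) (x, t) (1, 0) = laxOleinik f u₀ x t := by
  simp only [lineDeriv, laxOleinik, Prod.smul_mk, smul_eq_mul, mul_one, mul_zero, Prod.mk_add_mk,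
    add_zero]
  rw [deriv_comp_const_add (fun z => value f u₀ z t) x 0, add_zero]

lemma lineDeriv_value_time_of_neg (x : ℝ) {t : ℝ} (ht : t < 0) :
    lineDeriv ℝ (fun p : ℝ × ℝ => value f u₀ p.1 p.2) (x, t) (0, 1) = 0 := by
  simp only [lineDeriv, Prod.smul_mk, smul_eq_mul, mul_one, mul_zero, Prod.mk_add_mk, add_zero]
  have h : (fun s => value f u₀ x (t + s)) =ᶠ[𝓝 0] fun _ => primitive u₀ x := by
    filter_upwards [gt_mem_nhds (neg_pos.2 ht)] with s hs
    rw [value, if_neg (by linarith)]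
  rw [h.deriv_eq, deriv_const]

lemma laxOleinik_of_nonpos (x : ℝ) {t : ℝ} (ht : t ≤ 0) :
    laxOleinik f u₀ x t = deriv (primitive u₀) x := by
  simp only [laxOleinik, value, if_neg (not_lt.2 ht)]

/-- At a point of differentiability the value function is its own test function. -/
lemma lineDeriv_value_time_of_pos (hf : ConvexOn ℝ univ f) (hu : MemLp u₀ ⊤ volume) {p : ℝ × ℝ}
    (hp : 0 < p.2) (hd : DifferentiableAt ℝ (fun p : ℝ × ℝ => value f u₀ p.1 p.2) p) :
    lineDeriv ℝ (fun p : ℝ × ℝ => value f u₀ p.1 p.2) p (0, 1) = -f (laxOleinik f u₀ p.1 p.2) := by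
  have h1 := value_subsolution hf hu hp hd (by simp [IsLocalMax, IsMaxFilter])
  have h2 := value_supersolution hf hu hp hd (by simp [IsLocalMin, IsMinFilter])
  rw [← hd.lineDeriv_eq_fderiv, ← hd.lineDeriv_eq_fderiv, lineDeriv_value_space] at h1 h2
  linarith

lemma contDiff_fderiv_apply {φ : ℝ × ℝ → ℝ} (hφ : ContDiff ℝ ((⊤ : ℕ∞) : WithTop ℕ∞) φ)
    (v : ℝ × ℝ) : ContDiff ℝ 1 (fun p => fderiv ℝ φ p v) :=
  (ContDiff.fderiv_right (n := 2) (by exact_mod_cast contDiff_infty.1 hφ 2)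
    (by norm_num)).clm_apply contDiff_const

lemma lineDeriv_fderiv_comm {φ : ℝ × ℝ → ℝ} (hφ : ContDiff ℝ ((⊤ : ℕ∞) : WithTop ℕ∞) φ)
    (p v w : ℝ × ℝ) :
    lineDeriv ℝ (fun q => fderiv ℝ φ q v) p w = lineDeriv ℝ (fun q => fderiv ℝ φ q w) p v := by
  have hφ2 : ContDiff ℝ 2 φ := by exact_mod_cast contDiff_infty.1 hφ 2
  have hd : DifferentiableAt ℝ (fderiv ℝ φ) p :=
    ((hφ2.fderiv_right (m := 1) (by norm_num)).differentiable one_ne_zero) p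
  have hv : ∀ v, DifferentiableAt ℝ (fun q => fderiv ℝ φ q v) p := fun v =>
    hd.clm_apply (differentiableAt_const v)
  rw [(hv v).lineDeriv_eq_fderiv, (hv w).lineDeriv_eq_fderiv,
    fderiv_clm_apply hd (differentiableAt_const v), fderiv_clm_apply hd (differentiableAt_const w)]
  have hs : IsSymmSndFDerivAt ℝ φ p :=
    hφ2.contDiffAt.isSymmSndFDerivAt (by simp)
  simpa using hs.eq w v

/-- In the whole plane `∫ (V_x φ_t - V_t φ_x) = 0`, by integration by parts and the symmetry of the
second derivative of `φ`. -/
lemma integral_lineDeriv_mul_fderiv_comm {V φ : ℝ × ℝ → ℝ} {C : NNReal} (hV : LipschitzWith C V)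
    (hφ : ContDiff ℝ ((⊤ : ℕ∞) : WithTop ℕ∞) φ) (hφc : HasCompactSupport φ) (v w : ℝ × ℝ) :
    ∫ p, lineDeriv ℝ V p v * fderiv ℝ φ p w = ∫ p, lineDeriv ℝ V p w * fderiv ℝ φ p v := by
  have hc : ∀ v, HasCompactSupport (fun p => fderiv ℝ φ p v) := fun v =>
    hφc.fderiv_apply ℝ v
  obtain ⟨Cv, hCv⟩ := (contDiff_fderiv_apply hφ v).lipschitzWith_of_hasCompactSupport (hc v) one_ne_zero
  obtain ⟨Cw, hCw⟩ := (contDiff_fderiv_apply hφ w).lipschitzWith_of_hasCompactSupport (hc w) one_ne_zero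
  rw [hV.integral_lineDeriv_mul_eq hCw (hc w) v, hV.integral_lineDeriv_mul_eq hCv (hc v) w]
  simp_rw [lineDeriv_neg, lineDeriv_fderiv_comm hφ _ w v]

lemma integrable_lineDeriv_mul_fderiv {V φ : ℝ × ℝ → ℝ} {C : NNReal} (hV : LipschitzWith C V)
    (hφ : ContDiff ℝ ((⊤ : ℕ∞) : WithTop ℕ∞) φ) (hφc : HasCompactSupport φ) (v w : ℝ × ℝ) :
    Integrable (fun p => lineDeriv ℝ V p v * fderiv ℝ φ p w) := by
  have hi : Integrable (fun p => fderiv ℝ φ p w) :=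
    ((hφ.continuous_fderiv (by simp)).clm_apply continuous_const).integrable_of_hasCompactSupport
      (hφc.fderiv_apply ℝ w)
  refine hi.bdd_mul (c := C * ‖v‖) (aestronglyMeasurable_lineDeriv hV.continuous _)
    (Eventually.of_forall fun p => ?_)
  exact norm_lineDeriv_le_of_lipschitz ℝ hV

lemma integral_Iic_fderiv {φ : ℝ × ℝ → ℝ} (hφ : ContDiff ℝ ((⊤ : ℕ∞) : WithTop ℕ∞) φ)
    (hφc : HasCompactSupport φ) (x : ℝ) :
    ∫ t in Iic (0 : ℝ), fderiv ℝ φ (x, t) (0, 1) = φ (x, 0) := by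
  have hs : ContDiff ℝ 1 (fun t => φ (x, t)) :=
    (hφ.of_le (by exact_mod_cast le_top)).comp (contDiff_const.prodMk contDiff_id)
  have hc : HasCompactSupport (fun t => φ (x, t)) :=
    hφc.comp_isClosedEmbedding (Function.LeftInverse.isClosedEmbedding (f := Prod.snd)
      (fun _ => rfl) continuous_snd (by fun_prop))
  rw [← hc.integral_Iic_deriv_eq hs 0]
  refine integral_congr_ae (Eventually.of_forall fun t => ?_)
  have h1 : HasDerivAt (fun t => (x, t)) ((0 : ℝ), (1 : ℝ)) t :=
    (hasDerivAt_const t x).prodMk (hasDerivAt_id t)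
  exact (((hφ.differentiable (by simp)) (x, t)).hasFDerivAt.comp_hasDerivAt t h1).deriv.symm

/-- Below the initial line, where `V(x,t) = v₀(x)`, the weak formulation leaves only the trace of the
test function. -/
lemma integral_lowerHalf (hf : ConvexOn ℝ univ f) (hu : MemLp u₀ ⊤ volume) {φ : ℝ × ℝ → ℝ}
    (hφ : ContDiff ℝ ((⊤ : ℕ∞) : WithTop ℕ∞) φ) (hφc : HasCompactSupport φ) :
    ∫ p in upperHalfᶜ, (lineDeriv ℝ (fun p : ℝ × ℝ => value f u₀ p.1 p.2) p (1, 0) *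
        fderiv ℝ φ p (0, 1) - lineDeriv ℝ (fun p : ℝ × ℝ => value f u₀ p.1 p.2) p (0, 1) *
        fderiv ℝ φ p (1, 0)) = ∫ x, u₀ x * φ (x, 0) := by
  obtain ⟨C, hV⟩ := exists_lipschitzWith_value hf hu
  have hset : upperHalfᶜ = (univ : Set ℝ) ×ˢ Iic (0 : ℝ) := by
    ext p; simp [upperHalf]
  have hmeas : MeasurableSet (upperHalfᶜ : Set (ℝ × ℝ)) :=
    hset ▸ MeasurableSet.univ.prod measurableSet_Iic
  have hne : ∀ᵐ p : ℝ × ℝ, p.2 ≠ 0 :=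
    Measure.quasiMeasurePreserving_snd.ae (Measure.ae_ne volume (0 : ℝ))
  have hprim : ∀ᵐ p : ℝ × ℝ, deriv (primitive u₀) p.1 = u₀ p.1 :=
    Measure.quasiMeasurePreserving_fst.ae (ae_deriv_primitive hu)
  have hlow : ∀ᵐ p : ℝ × ℝ, p ∈ upperHalfᶜ →
      lineDeriv ℝ (fun p : ℝ × ℝ => value f u₀ p.1 p.2) p (1, 0) = u₀ p.1 ∧
      lineDeriv ℝ (fun p : ℝ × ℝ => value f u₀ p.1 p.2) p (0, 1) = 0 := by
    filter_upwards [hne, hprim] with p h1 h2 hp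
    have hp' : p.2 ≤ 0 := by simpa [upperHalf] using hp
    exact ⟨(lineDeriv_value_space p.1 p.2).trans ((laxOleinik_of_nonpos _ hp').trans h2),
      lineDeriv_value_time_of_neg p.1 (lt_of_le_of_ne hp' h1)⟩
  have hint : IntegrableOn (fun p : ℝ × ℝ => u₀ p.1 * fderiv ℝ φ p (0, 1)) upperHalfᶜ := by
    refine (integrable_lineDeriv_mul_fderiv hV hφ hφc (1, 0) (0, 1)).integrableOn.congr ?_
    rw [EventuallyEq, ae_restrict_iff' hmeas]
    filter_upwards [hlow] with p hp hmem
    rw [(hp hmem).1]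
  have h1 : ∫ p in upperHalfᶜ, (lineDeriv ℝ (fun p : ℝ × ℝ => value f u₀ p.1 p.2) p (1, 0) *
        fderiv ℝ φ p (0, 1) - lineDeriv ℝ (fun p : ℝ × ℝ => value f u₀ p.1 p.2) p (0, 1) *
        fderiv ℝ φ p (1, 0)) = ∫ p in upperHalfᶜ, u₀ p.1 * fderiv ℝ φ p (0, 1) := by
    refine setIntegral_congr_ae hmeas ?_
    filter_upwards [hlow] with p hp hmem
    rw [(hp hmem).1, (hp hmem).2, zero_mul, sub_zero]
  rw [h1, hset]
  rw [hset] at hint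
  rw [Measure.volume_eq_prod] at hint ⊢
  rw [setIntegral_prod _ hint, Measure.restrict_univ]
  simp_rw [integral_const_mul, integral_Iic_fderiv hφ hφc]

lemma isWeakSolution_laxOleinik (hf : ConvexOn ℝ univ f) (hu : MemLp u₀ ⊤ volume) :
    IsWeakSolution f u₀ (laxOleinik f u₀) := by
  refine ⟨memLp_laxOleinik hf hu, fun φ hφ hφc => ?_⟩
  obtain ⟨C, hV⟩ := exists_lipschitzWith_value hf hu
  have hmeas : MeasurableSet upperHalf := measurableSet_lt measurable_const measurable_snd
  have hi1 := integrable_lineDeriv_mul_fderiv hV hφ hφc (1, 0) (0, 1)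
  have hi2 := integrable_lineDeriv_mul_fderiv hV hφ hφc (0, 1) (1, 0)
  have h1 : ∫ p in upperHalf, (laxOleinik f u₀ p.1 p.2 * fderiv ℝ φ p (0, 1) +
      f (laxOleinik f u₀ p.1 p.2) * fderiv ℝ φ p (1, 0)) =
      ∫ p in upperHalf, (lineDeriv ℝ (fun p : ℝ × ℝ => value f u₀ p.1 p.2) p (1, 0) *
        fderiv ℝ φ p (0, 1) - lineDeriv ℝ (fun p : ℝ × ℝ => value f u₀ p.1 p.2) p (0, 1) *
        fderiv ℝ φ p (1, 0)) := by
    refine setIntegral_congr_ae hmeas ?_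
    filter_upwards [hV.ae_differentiableAt] with p hp hmem
    rw [lineDeriv_value_time_of_pos hf hu hmem hp, lineDeriv_value_space p.1 p.2]
    ring
  have h2 := integral_add_compl hmeas (hi1.sub hi2)
  rw [integral_sub' hi1 hi2, integral_lineDeriv_mul_fderiv_comm hV hφ hφc, sub_self] at h2
  rw [h1, ← integral_lowerHalf hf hu hφ hφc]
  exact h2

end weak

/-! ### The maximal speed -/

section speed

variable {f : ℝ → ℝ} {M : ℝ}

lemma ae_differentiableAt_of_convexOn (hf : ConvexOn ℝ univ f) :
    ∀ᵐ p, DifferentiableAt ℝ f p := by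
  have h : ∀ n : ℕ, ∀ᵐ p, p ∈ Ioo (-(n : ℝ)) n → DifferentiableAt ℝ f p := by
    intro n
    obtain ⟨α, hα⟩ := exists_isSubgradient hf (-(n : ℝ))
    obtain ⟨β, hβ⟩ := exists_isSubgradient hf n
    have key : ∀ x ∈ Ioo (-(n : ℝ)) n, ∀ y, f x - f y ≤ max |α| |β| * |x - y| := by
      intro x hx y
      obtain ⟨q, hq⟩ := exists_isSubgradient hf x
      have h1 : |q| ≤ max |α| |β| := abs_le_max_abs_abs (hα.mono hq hx.1) (hq.mono hβ hx.2)
      have h2 := hq y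
      have h3 : q * (x - y) ≤ |q| * |x - y| := (le_abs_self _).trans (abs_mul _ _).le
      have h4 := mul_le_mul_of_nonneg_right h1 (abs_nonneg (x - y))
      linarith
    have hL : LipschitzOnWith (max |α| |β|).toNNReal f (Ioo (-(n : ℝ)) n) := by
      refine LipschitzOnWith.of_dist_le_mul fun x hx y hy => ?_
      rw [Real.coe_toNNReal _ (by positivity), Real.dist_eq, Real.dist_eq, abs_sub_le_iff]
      refine ⟨key x hx y, ?_⟩
      rw [abs_sub_comm]
      exact key y hy x
    filter_upwards [hL.ae_differentiableWithinAt_of_mem_real] with p hp hmem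
    exact (hp hmem).differentiableAt (isOpen_Ioo.mem_nhds hmem)
  filter_upwards [ae_all_iff.2 h] with p hp
  obtain ⟨n, hn⟩ := exists_nat_gt |p|
  exact hp n (abs_lt.1 hn)

lemma eLpNorm_deriv_ne_top (hf : ConvexOn ℝ univ f) (M : ℝ) :
    eLpNorm (deriv f) ⊤ (volume.restrict (Icc (-M) M)) ≠ ⊤ := by
  obtain ⟨α, hα⟩ := exists_isSubgradient hf (-M - 1)
  obtain ⟨β, hβ⟩ := exists_isSubgradient hf (M + 1)
  rw [eLpNorm_exponent_top]
  refine ne_top_of_le_ne_top ENNReal.ofReal_ne_top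
    (eLpNormEssSup_le_of_ae_bound (C := max |α| |β|) ?_)
  rw [ae_restrict_iff' measurableSet_Icc]
  filter_upwards [ae_differentiableAt_of_convexOn hf] with p hp hmem
  have h := isSubgradient_deriv hf hp
  exact abs_le_max_abs_abs (hα.mono h (by linarith [hmem.1])) (h.mono hβ (by linarith [hmem.2]))

/-- The maximal speed bounds the subgradients at `±M`, since it is the limit of bounds for the
derivative of `f` on slightly larger intervals. -/
lemma exists_isMaxSpeed (hf : ConvexOn ℝ univ f) (hM : 0 ≤ M) :
    ∃ L, IsMaxSpeed f M L ∧
      (∀ β, IsSubgradient f M β → β ≤ L) ∧ (∀ α, IsSubgradient f (-M) α → -L ≤ α) := by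
  set F : ℝ → ℝ≥0∞ := fun ε => eLpNorm (deriv f) ⊤ (volume.restrict (Icc (-(M + ε)) (M + ε)))
    with hF
  have hmono : Monotone F := fun a b hab => eLpNorm_mono_measure _
    (Measure.restrict_mono (Icc_subset_Icc (by linarith) (by linarith)) le_rfl)
  have hfin : ∀ ε, F ε ≠ ⊤ := fun ε => eLpNorm_deriv_ne_top hf _
  have hlim := hmono.tendsto_nhdsGT 0
  set ℓ := sInf (F '' Ioi 0)
  have hℓ : ℓ ≠ ⊤ := ne_top_of_le_ne_top (hfin 1) (sInf_le ⟨1, mem_Ioi.2 one_pos, rfl⟩)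
  -- Every open interval inside `[-(M + ε), M + ε]` contains a point with `|f'| ≤ F ε`.
  have hpt : ∀ ε a b, a < b → Ioo a b ⊆ Icc (-(M + ε)) (M + ε) →
      ∃ p ∈ Ioo a b, IsSubgradient f p (deriv f p) ∧ |deriv f p| ≤ (F ε).toReal := by
    intro ε a b hab hsub
    have h1 := ae_le_eLpNormEssSup (f := deriv f) (μ := volume.restrict (Icc (-(M + ε)) (M + ε)))
    rw [← eLpNorm_exponent_top, ae_restrict_iff' measurableSet_Icc] at h1
    obtain ⟨p, ⟨hp1, hp2⟩, hp⟩ := (Measure.dense_of_ae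
      ((ae_differentiableAt_of_convexOn hf).and h1)).exists_mem_open isOpen_Ioo
      (nonempty_Ioo.2 hab)
    refine ⟨p, hp, isSubgradient_deriv hf hp1, ?_⟩
    have := ENNReal.toReal_mono (hfin ε) (hp2 (hsub hp))
    simpa using this
  have hle : ∀ c : ℝ, (∀ ε, 0 < ε → c ≤ (F ε).toReal) → c ≤ ℓ.toReal := by
    intro c hc
    refine ge_of_tendsto ((ENNReal.tendsto_toReal hℓ).comp hlim) ?_
    filter_upwards [self_mem_nhdsWithin] with ε hε using hc ε hε
  refine ⟨ℓ.toReal, ⟨ENNReal.toReal_nonneg, ?_⟩, fun β hβ => hle β fun ε hε => ?_, fun α hα => ?_⟩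
  · rwa [ENNReal.ofReal_toReal hℓ]
  · obtain ⟨p, hp, h1, h2⟩ := hpt ε M (M + ε) (by linarith) fun y hy =>
      ⟨by linarith [hy.1], hy.2.le⟩
    exact (hβ.mono h1 hp.1).trans ((le_abs_self _).trans h2)
  · refine neg_le.1 (hle (-α) fun ε hε => ?_)
    obtain ⟨p, hp, h1, h2⟩ := hpt ε (-(M + ε)) (-M) (by linarith) fun y hy =>
      ⟨hy.1.le, by linarith [hy.2]⟩
    have := h1.mono hα hp.2
    linarith [neg_abs_le (deriv f p)]

/-- The speeds in the Hopf–Lax formula for `M`-Lipschitz initial values are at most the maximal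
speed. -/
lemma exists_lagrangian_isMaxSpeed (hf : ConvexOn ℝ univ f) (hM : 0 ≤ M) :
    ∃ L, IsMaxSpeed f M L ∧ ∃ g α β, IsLagrangian g M α β ∧ IsDualOn f g α β ∧
      -L ≤ α ∧ β ≤ L := by
  obtain ⟨L, hL, h1, h2⟩ := exists_isMaxSpeed hf hM
  obtain ⟨α, β, hαβ, hα, hβ⟩ := exists_ordered_subgradients hf hM
  exact ⟨L, hL, _, α, β, isLagrangian_truncatedDual hf hM hαβ hα hβ,
    isDualOn_truncatedDual hf hM hα hβ, h2 α hα, h1 β hβ⟩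

end speed

/-! ### The `L¹` contraction -/

section contraction

variable {f g : ℝ → ℝ} {M α β : ℝ}

/-- The evolution preserves monotonicity of differences of initial values. The optimal rays for `w`
from `y` and for `v` from `x` are used directly if their feet are ordered like `x ≤ y`; otherwise
their feet are exchanged, which costs nothing by convexity of `g`. -/
lemma monotone_evolution_sub (hg : IsLagrangian g M α β) {v w : ℝ → ℝ}
    (hv : ∀ x y, |v x - v y| ≤ M * |x - y|) (hw : ∀ x y, |w x - w y| ≤ M * |x - y|)
    (hmono : Monotone fun x => w x - v x) {t : ℝ} (ht : 0 ≤ t) :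
    Monotone fun x => evolution g w x t - evolution g v x t := by
  intro x y hxy
  simp only
  obtain ⟨q, -, hq⟩ := exists_evolution_eq hg hw y ht
  obtain ⟨r, -, hr⟩ := exists_evolution_eq hg hv x ht
  rcases le_or_gt (x - t * r) (y - t * q) with h | h
  · have h1 := evolution_le hg hw x ht r
    have h2 := evolution_le hg hv y ht q
    have h3 := hmono h
    simp only at h3
    linarith
  · have ht0 : 0 < t := by
      rcases ht.eq_or_lt with rfl | h0
      · simp only [zero_mul, sub_zero] at h; linarith
      · exact h0
    -- The two new speeds lie between `r` and `q` and have the same sum.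
    set c := (y - x) / t with hc
    have htc : t * c = y - x := by rw [hc]; field_simp
    have hc0 : 0 ≤ c := div_nonneg (by linarith) ht
    have hrq : r + c < q := by
      by_contra hcon
      have := mul_le_mul_of_nonneg_left (not_lt.1 hcon) ht
      linarith
    have h1 := evolution_le hg hw x ht (q - c)
    have h2 := evolution_le hg hv y ht (r + c)
    rw [show x - t * (q - c) = y - t * q by linarith] at h1
    rw [show y - t * (r + c) = x - t * r by linarith] at h2
    have hd : 0 < q - r := by linarith
    have e1 := hg.convex.2 (mem_univ r) (mem_univ q)
      (show 0 ≤ (q - r - c) / (q - r) from div_nonneg (by linarith) hd.le)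
      (show 0 ≤ c / (q - r) from div_nonneg hc0 hd.le)
      (by field_simp; ring)
    have e2 := hg.convex.2 (mem_univ r) (mem_univ q)
      (show 0 ≤ c / (q - r) from div_nonneg hc0 hd.le)
      (show 0 ≤ (q - r - c) / (q - r) from div_nonneg (by linarith) hd.le)
      (by field_simp; ring)
    simp only [smul_eq_mul] at e1 e2
    rw [show (q - r - c) / (q - r) * r + c / (q - r) * q = r + c by field_simp; ring] at e1
    rw [show c / (q - r) * r + (q - r - c) / (q - r) * q = q - c by field_simp; ring] at e2
    have e3 : (q - r - c) / (q - r) * g r + c / (q - r) * g q +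
        (c / (q - r) * g r + (q - r - c) / (q - r) * g q) = g r + g q := by
      field_simp; ring
    have e4 := mul_le_mul_of_nonneg_left (show g (r + c) + g (q - c) ≤ g r + g q by linarith) ht
    linarith

/-- If `w - v` is monotone, the increment of the difference of the evolutions over `[a, b]` is at
most that of `w - v` over the interval widened by the distance travelled at the maximal speed. -/
lemma evolution_sub_increment_le (hg : IsLagrangian g M α β) {L : ℝ} (hα : -L ≤ α) (hβ : β ≤ L)
    {v w : ℝ → ℝ}
    (hv : ∀ x y, |v x - v y| ≤ M * |x - y|) (hw : ∀ x y, |w x - w y| ≤ M * |x - y|)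
    (hmono : Monotone fun x => w x - v x) {t : ℝ} (ht : 0 ≤ t) (a b : ℝ) :
    (evolution g w b t - evolution g v b t) - (evolution g w a t - evolution g v a t) ≤
      (w (b + L * t) - v (b + L * t)) - (w (a - L * t) - v (a - L * t)) := by
  obtain ⟨q, hq, hqv⟩ := exists_evolution_eq hg hv b ht
  obtain ⟨r, hr, hrw⟩ := exists_evolution_eq hg hw a ht
  have h1 := evolution_le hg hw b ht q
  have h2 := evolution_le hg hv a ht r
  have h3 : b - t * q ≤ b + L * t := by
    have := mul_le_mul_of_nonneg_left (hα.trans hq.1) ht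
    linarith
  have h4 : a - L * t ≤ a - t * r := by
    have := mul_le_mul_of_nonneg_left (hr.2.trans hβ) ht
    linarith
  have h5 := hmono h3
  have h6 := hmono h4
  simp only at h5 h6
  linarith

lemma memLp_max {u v : ℝ → ℝ} (hu : MemLp u ⊤ volume) (hv : MemLp v ⊤ volume) :
    MemLp (fun x => max (u x) (v x)) ⊤ volume := hu.sup hv

lemma supNorm_max_le {u v : ℝ → ℝ} (hu : MemLp u ⊤ volume) (hv : MemLp v ⊤ volume) :
    supNorm (fun x => max (u x) (v x)) ≤ max (supNorm u) (supNorm v) := by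
  have h : eLpNorm (fun x => max (u x) (v x)) ⊤ volume ≤
      ENNReal.ofReal (max (supNorm u) (supNorm v)) := by
    rw [eLpNorm_exponent_top]
    refine eLpNormEssSup_le_of_ae_bound ?_
    filter_upwards [ae_abs_le_supNorm hu, ae_abs_le_supNorm hv] with x h1 h2
    exact abs_max_le_max_abs_abs.trans (max_le_max h1 h2)
  have := ENNReal.toReal_mono ENNReal.ofReal_ne_top h
  rwa [ENNReal.toReal_ofReal (le_max_of_le_left (supNorm_nonneg u))] at this

lemma monotone_primitive_sub {u v : ℝ → ℝ} (hu : MemLp u ⊤ volume) (hv : MemLp v ⊤ volume)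
    (huv : ∀ x, v x ≤ u x) : Monotone fun x => primitive u x - primitive v x := by
  intro x y hxy
  simp only
  have h := intervalIntegral.integral_mono hxy (intervalIntegrable_of_memLp_top hv x y)
    (intervalIntegrable_of_memLp_top hu x y) huv
  rw [← primitive_sub hv, ← primitive_sub hu] at h
  linarith

section

variable {u₀ : ℝ → ℝ}

lemma intervalIntegrable_laxOleinik (hf : ConvexOn ℝ univ f) (hu : MemLp u₀ ⊤ volume)
    (t a b : ℝ) : IntervalIntegrable (fun x => laxOleinik f u₀ x t) volume a b :=
  ((lipschitzWith_value_slice hf hu t).lipschitzOnWith.absolutelyContinuousOnInterval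
    ).intervalIntegrable_deriv

lemma integral_laxOleinik (hf : ConvexOn ℝ univ f) (hu : MemLp u₀ ⊤ volume) (t a b : ℝ) :
    ∫ x in a..b, laxOleinik f u₀ x t = value f u₀ b t - value f u₀ a t :=
  ((lipschitzWith_value_slice hf hu t).lipschitzOnWith.absolutelyContinuousOnInterval
    ).integral_deriv_eq_sub

lemma ae_differentiableAt_value (hf : ConvexOn ℝ univ f) (hu : MemLp u₀ ⊤ volume) (t : ℝ) :
    ∀ᵐ x, DifferentiableAt ℝ (fun z => value f u₀ z t) x :=
  (lipschitzWith_value_slice hf hu t).ae_differentiableAt_real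

end

/-- Comparison with the solution `u` started from `max(u₁₀, u₂₀)`, which lies above both solutions:
`|u₁ - u₂| ≤ (u - u₁) + (u - u₂)`, with equality at `t = 0`. -/
lemma integral_abs_laxOleinik_sub_le (hf : ConvexOn ℝ univ f) (hg : IsLagrangian g M α β)
    (hfg : IsDualOn f g α β) {L : ℝ} (hα : -L ≤ α) (hβ : β ≤ L) {u₁ u₂ : ℝ → ℝ}
    (hu₁ : MemLp u₁ ⊤ volume) (hu₂ : MemLp u₂ ⊤ volume) (hM₁ : supNorm u₁ ≤ M)
    (hM₂ : supNorm u₂ ≤ M) {t : ℝ} (ht : 0 ≤ t) {a b : ℝ} (hab : a ≤ b) :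
    ∫ x in a..b, |laxOleinik f u₁ x t - laxOleinik f u₂ x t| ≤
      ∫ x in (a - L * t)..(b + L * t), |u₁ x - u₂ x| := by
  set u : ℝ → ℝ := fun x => max (u₁ x) (u₂ x)
  have hu : MemLp u ⊤ volume := memLp_max hu₁ hu₂
  have hMu : supNorm u ≤ M := (supNorm_max_le hu₁ hu₂).trans (max_le hM₁ hM₂)
  have hlip : ∀ {v : ℝ → ℝ}, MemLp v ⊤ volume → supNorm v ≤ M →
      ∀ x y, |primitive v x - primitive v y| ≤ M * |x - y| := fun hv hM x y =>
    (abs_primitive_sub_le hv x y).trans (mul_le_mul_of_nonneg_right hM (abs_nonneg _))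
  have hval : ∀ {v : ℝ → ℝ}, MemLp v ⊤ volume → supNorm v ≤ M →
      ∀ x, value f v x t = evolution g (primitive v) x t := fun hv hM x => by
    rw [value_eq_evolution hg hfg hv hM, max_eq_left ht]
  have hstep : ∀ {v : ℝ → ℝ}, MemLp v ⊤ volume → supNorm v ≤ M → (∀ x, v x ≤ u x) →
      (∀ᵐ x, laxOleinik f v x t ≤ laxOleinik f u x t) ∧
      ∫ x in a..b, (laxOleinik f u x t - laxOleinik f v x t) ≤
        ∫ x in (a - L * t)..(b + L * t), (u x - v x) := by
    intro v hv hM hvu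
    have hmono := monotone_primitive_sub hu hv hvu
    constructor
    · filter_upwards [ae_differentiableAt_value hf hu t, ae_differentiableAt_value hf hv t]
        with x h1 h2
      have h3 : Monotone ((fun z => value f u z t) - fun z => value f v z t) := by
        intro y z hyz
        simpa [hval hu hMu, hval hv hM] using
          monotone_evolution_sub hg (hlip hv hM) (hlip hu hMu) hmono ht hyz
      have h4 := h3.deriv_nonneg (x := x)
      rw [deriv_sub h1 h2] at h4
      exact sub_nonneg.1 h4
    · rw [intervalIntegral.integral_sub (intervalIntegrable_laxOleinik hf hu t a b)
        (intervalIntegrable_laxOleinik hf hv t a b), integral_laxOleinik hf hu,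
        integral_laxOleinik hf hv,
        intervalIntegral.integral_sub (intervalIntegrable_of_memLp_top hu _ _)
          (intervalIntegrable_of_memLp_top hv _ _), ← primitive_sub hu, ← primitive_sub hv]
      simp only [hval hu hMu, hval hv hM]
      have := evolution_sub_increment_le hg hα hβ (hlip hv hM) (hlip hu hMu) hmono ht a b
      linarith
  obtain ⟨h1, h1'⟩ := hstep hu₁ hM₁ fun x => le_max_left _ _
  obtain ⟨h2, h2'⟩ := hstep hu₂ hM₂ fun x => le_max_right _ _
  have hi := fun {v : ℝ → ℝ} (hv : MemLp v ⊤ volume) => intervalIntegrable_laxOleinik hf hv t a b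
  have hj := fun {v : ℝ → ℝ} (hv : MemLp v ⊤ volume) =>
    intervalIntegrable_of_memLp_top hv (a - L * t) (b + L * t)
  calc ∫ x in a..b, |laxOleinik f u₁ x t - laxOleinik f u₂ x t|
      ≤ ∫ x in a..b, ((laxOleinik f u x t - laxOleinik f u₁ x t) +
          (laxOleinik f u x t - laxOleinik f u₂ x t)) := by
        refine intervalIntegral.integral_mono_ae hab ((hi hu₁).sub (hi hu₂)).abs
          (((hi hu).sub (hi hu₁)).add ((hi hu).sub (hi hu₂))) ?_
        filter_upwards [h1, h2] with x h1 h2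
        rw [abs_le]
        constructor <;> linarith
    _ = (∫ x in a..b, (laxOleinik f u x t - laxOleinik f u₁ x t)) +
          ∫ x in a..b, (laxOleinik f u x t - laxOleinik f u₂ x t) :=
        intervalIntegral.integral_add ((hi hu).sub (hi hu₁)) ((hi hu).sub (hi hu₂))
    _ ≤ (∫ x in (a - L * t)..(b + L * t), (u x - u₁ x)) +
          ∫ x in (a - L * t)..(b + L * t), (u x - u₂ x) := add_le_add h1' h2'
    _ = ∫ x in (a - L * t)..(b + L * t), ((u x - u₁ x) + (u x - u₂ x)) :=
        (intervalIntegral.integral_add ((hj hu).sub (hj hu₁)) ((hj hu).sub (hj hu₂))).symm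
    _ = ∫ x in (a - L * t)..(b + L * t), |u₁ x - u₂ x| := by
        refine intervalIntegral.integral_congr fun x _ => ?_
        rcases le_total (u₁ x) (u₂ x) with h | h
        · simp only [u, max_eq_right h, abs_of_nonpos (sub_nonpos.2 h)]; ring
        · simp only [u, max_eq_left h, abs_of_nonneg (sub_nonneg.2 h)]; ring

end contraction

end LaxOleinik

theorem theorem1 (f : ℝ → ℝ) (hf : ConvexOn ℝ Set.univ f) :
    (∀ u₀ : ℝ → ℝ, MemLp u₀ ⊤ volume →
      -- the infimum defining `V` is finite
      (∀ x t : ℝ, 0 < t → LaxOleinik.hopfLax f (LaxOleinik.primitive u₀) x t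
        = ((LaxOleinik.value f u₀ x t : ℝ) : EReal)) ∧
      -- `V` is Lipschitz, with constant `Lip(v₀)` in `x`
      (∀ x y t : ℝ, 0 < t → |LaxOleinik.value f u₀ x t - LaxOleinik.value f u₀ y t|
        ≤ LaxOleinik.lipConst (LaxOleinik.primitive u₀) * |x - y|) ∧
      (∃ C : ℝ, ∀ x y s t : ℝ, 0 ≤ s → 0 ≤ t →
        |LaxOleinik.value f u₀ x t - LaxOleinik.value f u₀ y s|
          ≤ LaxOleinik.lipConst (LaxOleinik.primitive u₀) * |x - y| + C * |t - s|) ∧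
      -- dynamic programming principle
      (∀ x s t : ℝ, 0 ≤ s → s < t →
        LaxOleinik.value₂ f u₀ x s t = ((LaxOleinik.value f u₀ x t : ℝ) : EReal)) ∧
      -- Hamilton–Jacobi equation
      LaxOleinik.IsViscositySolution f (LaxOleinik.primitive u₀) (LaxOleinik.value f u₀) ∧
      -- `u = ∂V/∂x` exists a.e. and is a weak solution with `‖u‖_∞ ≤ ‖u₀‖_∞`
      (∀ t : ℝ, 0 < t → ∀ᵐ x : ℝ,
        DifferentiableAt ℝ (fun z => LaxOleinik.value f u₀ z t) x) ∧
      LaxOleinik.IsWeakSolution f u₀ (LaxOleinik.laxOleinik f u₀) ∧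
      eLpNorm (fun p : ℝ × ℝ => LaxOleinik.laxOleinik f u₀ p.1 p.2) ⊤
          (volume.restrict LaxOleinik.upperHalf) ≤ eLpNorm u₀ ⊤ volume) ∧
    -- local `L¹` contraction
    (∀ u₁₀ u₂₀ : ℝ → ℝ, MemLp u₁₀ ⊤ volume → MemLp u₂₀ ⊤ volume →
      ∃ L : ℝ,
        LaxOleinik.IsMaxSpeed f (max (LaxOleinik.supNorm u₁₀) (LaxOleinik.supNorm u₂₀)) L ∧
        ∀ᵐ t : ℝ, 0 < t → ∀ a b : ℝ, a < b →
          ∫ x in a..b, |LaxOleinik.laxOleinik f u₁₀ x t - LaxOleinik.laxOleinik f u₂₀ x t|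
            ≤ ∫ x in (a - L * t)..(b + L * t), |u₁₀ x - u₂₀ x|) := by
  refine ⟨fun u₀ hu => ⟨fun x t ht => ?_, fun x y t _ => LaxOleinik.abs_value_sub_le hf hu x y t,
    LaxOleinik.exists_abs_value_sub_value_le hf hu,
    fun x s t hs hst => LaxOleinik.value₂_eq_value hf hu hs hst x,
    LaxOleinik.isViscositySolution_value hf hu,
    fun t _ => LaxOleinik.ae_differentiableAt_value hf hu t,
    LaxOleinik.isWeakSolution_laxOleinik hf hu, LaxOleinik.eLpNorm_laxOleinik_le hf hu⟩,
    fun u₁₀ u₂₀ hu₁ hu₂ => ?_⟩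
  · have h := LaxOleinik.value₂_eq_value hf hu le_rfl ht x
    simpa [LaxOleinik.value₂, LaxOleinik.value] using h
  · obtain ⟨L, hL, g, α, β, hg, hfg, hα, hβ⟩ := LaxOleinik.exists_lagrangian_isMaxSpeed hf
      (le_max_of_le_left (LaxOleinik.supNorm_nonneg u₁₀) :
        0 ≤ max (LaxOleinik.supNorm u₁₀) (LaxOleinik.supNorm u₂₀))
    exact ⟨L, hL, MeasureTheory.ae_of_all _ fun t ht a b hab =>
      LaxOleinik.integral_abs_laxOleinik_sub_le hf hg hfg hα hβ hu₁ hu₂ (le_max_left _ _)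
        (le_max_right _ _) ht.le hab.le⟩
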